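/- Let $A$ be an octonion division algebra over a field $F$ of arbitrary characteristic (a Cayley--Dickson double of a quaternion algebra over $F$ in which left and right multiplication by every nonzero element are bijective), with canonical involution $z\mapsto\bar z$, trace $\operatorname{Tr}(z)=z+\bar z\in F$ and norm $\operatorname{Norm}(z)=\bar z z\in F$. Let $A[x]=A\otimes_F F[x]$ be the ring of polynomials in a central indeterminate. For $f=c_nx^n+\dots+c_0\in A[x]$ and $\lambda\in A$ put $\bar f=\bar c_nx^n+\dots+\bar c_0$, $C_f=\bar f f$ (the companion polynomial) and $f(\lambda)=c_n\lambda^n+\dots+c_1\lambda+c_0$; $\lambda$ is a root of $f$ if $f(\lambda)=0$. Elements $\lambda,\gamma\in A$ are conjugate if $\lambda=u\gamma u^{-1}$ for some nonzero $u\in A$. Let $f\in A[x]$ have degree $n\ge 0$ and leading coefficient $c\ne 0$. Then $f$ factors into linear factors $$f(x)=((\cdots(c(x-\lambda_n))\cdots)(x-\lambda_2))(x-\lambda_1)\qquad(1)$$ for some $\lambda_1,\dots,\lambda_n\in A$ if and only if $$C_f(x)=\operatorname{Norm}(c)\prod_{k=1}^n\bigl(x^2-\operatorname{Tr}(\gamma_k)x+\operatorname{Norm}(\gamma_k)\bigr)\qquad(2)$$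 for some $\gamma_1,\dots,\gamma_n\in A$. Moreover: (a) for all $\gamma_1,\dots,\gamma_n$ satisfying (2) there are $\lambda_1,\dots,\lambda_n$ satisfying (1) such that $\lambda_k$ is conjugate to $\gamma_k$ for every $k$; (b) for all $\lambda_1,\dots,\lambda_n$ satisfying (1) and all $\gamma_1,\dots,\gamma_n$ satisfying (2) there is a permutation $\sigma$ of $\{1,\dots,n\}$ such that $\lambda_k$ is conjugate to $\gamma_{\sigma(k)}$ for every $k$; (c) for all $\lambda_1,\dots,\lambda_n$ satisfying (1), an element of $A$ is conjugate to some $\lambda_k$ if and only if it is conjugate to some root of $f$. -/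

import Mathlib

open scoped TensorProduct Polynomial

noncomputable section

/-- The Cayley-Dickson double `Q ⊕ Q ℓ`, with `ℓ ^ 2 = d`, of the algebra `Q = ℍ[R, a, b, c]` with
basis `1, i, j, ij` and `i ^ 2 = a + b i`, `j ^ 2 = c`, `j i = (b - i) j`.

Over a field `R`, if `b ^ 2 + 4 * a`, `c` and `d` are nonzero then `Q` is a quaternion algebra and
the double is an octonion algebra; every octonion algebra over `R` is of this form, with `b = 0`
if `char R ≠ 2` and with `b = 1` if `char R = 2`. The pair `(q, r)` stands for `q + r ℓ`. -/
@[ext]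
structure OctonionAlgebra (R : Type*) (a b c d : R) where
  fst : QuaternionAlgebra R a b c
  snd : QuaternionAlgebra R a b c

namespace OctonionAlgebra

set_option linter.unusedSectionVars false

section Ring

variable {R : Type*} [CommRing R] {a b c d : R}

instance : Zero (OctonionAlgebra R a b c d) := ⟨⟨0, 0⟩⟩
instance : One (OctonionAlgebra R a b c d) := ⟨⟨1, 0⟩⟩
instance : Add (OctonionAlgebra R a b c d) := ⟨fun x y => ⟨x.fst + y.fst, x.snd + y.snd⟩⟩
instance : Neg (OctonionAlgebra R a b c d) := ⟨fun x => ⟨-x.fst, -x.snd⟩⟩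
instance : Sub (OctonionAlgebra R a b c d) := ⟨fun x y => ⟨x.fst - y.fst, x.snd - y.snd⟩⟩
instance {S : Type*} [SMul S R] : SMul S (OctonionAlgebra R a b c d) :=
  ⟨fun s x => ⟨s • x.fst, s • x.snd⟩⟩

/-- `(q + r ℓ) (s + t ℓ) = (q s + d t̄ r) + (r s̄ + t q) ℓ`. -/
instance : Mul (OctonionAlgebra R a b c d) :=
  ⟨fun x y => ⟨x.fst * y.fst + d • (star y.snd * x.snd), x.snd * star y.fst + y.snd * x.fst⟩⟩

@[simp] theorem fst_zero : (0 : OctonionAlgebra R a b c d).fst = 0 := rfl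
@[simp] theorem snd_zero : (0 : OctonionAlgebra R a b c d).snd = 0 := rfl
@[simp] theorem fst_one : (1 : OctonionAlgebra R a b c d).fst = 1 := rfl
@[simp] theorem snd_one : (1 : OctonionAlgebra R a b c d).snd = 0 := rfl
@[simp] theorem fst_add (x y : OctonionAlgebra R a b c d) : (x + y).fst = x.fst + y.fst := rfl
@[simp] theorem snd_add (x y : OctonionAlgebra R a b c d) : (x + y).snd = x.snd + y.snd := rfl
@[simp] theorem fst_neg (x : OctonionAlgebra R a b c d) : (-x).fst = -x.fst := rfl
@[simp] theorem snd_neg (x : OctonionAlgebra R a b c d) : (-x).snd = -x.snd := rfl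
@[simp] theorem fst_sub (x y : OctonionAlgebra R a b c d) : (x - y).fst = x.fst - y.fst := rfl
@[simp] theorem snd_sub (x y : OctonionAlgebra R a b c d) : (x - y).snd = x.snd - y.snd := rfl
@[simp] theorem fst_smul {S : Type*} [SMul S R] (s : S) (x : OctonionAlgebra R a b c d) :
    (s • x).fst = s • x.fst := rfl
@[simp] theorem snd_smul {S : Type*} [SMul S R] (s : S) (x : OctonionAlgebra R a b c d) :
    (s • x).snd = s • x.snd := rfl
@[simp] theorem fst_mul (x y : OctonionAlgebra R a b c d) :
    (x * y).fst = x.fst * y.fst + d • (star y.snd * x.snd) := rfl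
@[simp] theorem snd_mul (x y : OctonionAlgebra R a b c d) :
    (x * y).snd = x.snd * star y.fst + y.snd * x.fst := rfl

theorem toProd_injective : Function.Injective
    (fun x : OctonionAlgebra R a b c d => (x.fst, x.snd)) :=
  fun _ _ h => OctonionAlgebra.ext (congrArg Prod.fst h) (congrArg Prod.snd h)

instance : AddCommGroup (OctonionAlgebra R a b c d) :=
  toProd_injective.addCommGroup _ rfl (fun _ _ => rfl) (fun _ => rfl) (fun _ _ => rfl)
    (fun _ _ => rfl) (fun _ _ => rfl)

instance : Module R (OctonionAlgebra R a b c d) :=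
  toProd_injective.module R
    { toFun := fun x => (x.fst, x.snd), map_zero' := rfl, map_add' := fun _ _ => rfl }
    (fun _ _ => rfl)

/-- The ring structure is not associative in general. -/
instance : NonAssocRing (OctonionAlgebra R a b c d) where
  left_distrib x y z := by ext <;> simp <;> ring
  right_distrib x y z := by ext <;> simp <;> ring
  zero_mul x := by ext <;> simp
  mul_zero x := by ext <;> simp
  one_mul x := by ext <;> simp
  mul_one x := by ext <;> simp

instance : IsScalarTower R (OctonionAlgebra R a b c d) (OctonionAlgebra R a b c d) where
  smul_assoc r x y := by ext <;> simp <;> ring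

instance : SMulCommClass R (OctonionAlgebra R a b c d) (OctonionAlgebra R a b c d) where
  smul_comm r x y := by ext <;> simp <;> ring

/-- The canonical involution `q + r ℓ ↦ q̄ - r ℓ`. -/
def conj : OctonionAlgebra R a b c d →ₗ[R] OctonionAlgebra R a b c d where
  toFun x := ⟨star x.fst, -x.snd⟩
  map_add' x y := by ext <;> simp <;> ring
  map_smul' r x := by ext <;> simp

/-- The trace `z + z̄`, an element of `R`; see `trace_smul_one`. -/
def trace (z : OctonionAlgebra R a b c d) : R := (z + conj z).fst.re

/-- The norm `z̄ z`, an element of `R`; see `norm_smul_one`. -/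
def norm (z : OctonionAlgebra R a b c d) : R := (conj z * z).fst.re

theorem trace_smul_one (z : OctonionAlgebra R a b c d) :
    trace z • (1 : OctonionAlgebra R a b c d) = z + conj z := by
  ext <;> simp [trace, conj]

theorem norm_smul_one (z : OctonionAlgebra R a b c d) :
    norm z • (1 : OctonionAlgebra R a b c d) = conj z * z := by
  ext <;> simp [norm, conj] <;> ring

/-- The powers of an element, `z ^ 0 = 1` and `z ^ (k + 1) = z ^ k * z`. -/
def pow (z : OctonionAlgebra R a b c d) : ℕ → OctonionAlgebra R a b c d
  | 0 => 1
  | k + 1 => pow z k * z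

/-- The algebra is a division algebra: left and right multiplication by any nonzero element are
bijective. -/
def IsDivision (R : Type*) [CommRing R] (a b c d : R) : Prop :=
  ∀ z : OctonionAlgebra R a b c d, z ≠ 0 →
    Function.Bijective (fun w : OctonionAlgebra R a b c d => z * w) ∧
    Function.Bijective (fun w : OctonionAlgebra R a b c d => w * z)

/-- `y` is an inner conjugate of `x`: `y = u x u⁻¹` for some invertible `u` (here `v = u⁻¹`). -/
def IsInnerConj (x y : OctonionAlgebra R a b c d) : Prop :=
  ∃ u v : OctonionAlgebra R a b c d, u * v = 1 ∧ v * u = 1 ∧ y = (u * x) * v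

end Ring

end OctonionAlgebra

/-- The ring `A[x] = A ⊗ F[x]` of polynomials in a central indeterminate over the octonion algebra
`A = OctonionAlgebra F a b c d`. -/
abbrev OctonionPoly (F : Type*) [Field F] (a b c d : F) : Type _ :=
  OctonionAlgebra F a b c d ⊗[F] F[X]

namespace OctonionPoly

variable {F : Type*} [Field F] {a b c d : F}

/-- The constant polynomial `z`. -/
def const (z : OctonionAlgebra F a b c d) : OctonionPoly F a b c d := z ⊗ₜ[F] (1 : F[X])

/-- The inclusion of `F[x]` in `A[x]`. -/
def ofCentral (p : F[X]) : OctonionPoly F a b c d := (1 : OctonionAlgebra F a b c d) ⊗ₜ[F] p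

/-- The coefficient of `x ^ k`. -/
def coeff (k : ℕ) : OctonionPoly F a b c d →ₗ[F] OctonionAlgebra F a b c d :=
  (TensorProduct.rid F (OctonionAlgebra F a b c d)).toLinearMap ∘ₗ
    LinearMap.lTensor (OctonionAlgebra F a b c d) (Polynomial.lcoeff F k)

/-- The polynomial `f` has degree `n` and leading coefficient `e`. -/
def HasLeadingTerm (f : OctonionPoly F a b c d) (n : ℕ) (e : OctonionAlgebra F a b c d) : Prop :=
  coeff n f = e ∧ e ≠ 0 ∧ ∀ k, n < k → coeff k f = 0

/-- The substitution map `f = ∑ c_k x ^ k ↦ f(z) = ∑ c_k z ^ k`. -/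
def eval (z : OctonionAlgebra F a b c d) :
    OctonionPoly F a b c d →ₗ[F] OctonionAlgebra F a b c d :=
  TensorProduct.lift <|
    (LinearMap.mul F (OctonionAlgebra F a b c d)).compl₂
      (Polynomial.lsum fun k => LinearMap.toSpanSingleton F (OctonionAlgebra F a b c d) (z.pow k))

/-- The coefficientwise canonical involution `f ↦ f̄`. -/
def conj : OctonionPoly F a b c d →ₗ[F] OctonionPoly F a b c d :=
  LinearMap.rTensor F[X] OctonionAlgebra.conj

/-- The companion polynomial `C_f = f̄ f`. -/
def companion (f : OctonionPoly F a b c d) : OctonionPoly F a b c d := conj f * f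

/-- The polynomial `x - z`. -/
def linear (z : OctonionAlgebra F a b c d) : OctonionPoly F a b c d :=
  ofCentral Polynomial.X - const z

/-- The product `((⋯(e (x - l_n))⋯)(x - l_2))(x - l_1)`, where `l_k` is `l (k - 1)`. -/
def linearProd (e : OctonionAlgebra F a b c d) :
    {n : ℕ} → (Fin n → OctonionAlgebra F a b c d) → OctonionPoly F a b c d
  | 0, _ => const e
  | _ + 1, l => linearProd e (Fin.tail l) * linear (l 0)

/-- The polynomial `x ^ 2 - Tr(z) x + Norm(z)` over `F`. -/
def quadratic (z : OctonionAlgebra F a b c d) : F[X] :=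
  Polynomial.X ^ 2 - Polynomial.C z.trace * Polynomial.X + Polynomial.C z.norm

end OctonionPoly

end

/-!
The argument turns on the polynomial `N(f) ∈ F[x]` with `f̄ f = N(f)` (`normPoly`). The algebra
`A[x]` embeds in the octonion algebra over `F[x]` with the same parameters (`toExtended`), where
the norm is multiplicative; so `N(f g) = N(f) N(g)`, and `N(x - z)` is the quadratic polynomial
`q_z` of `z`. A factorization of `f` into linear factors thus yields a decomposition of the
companion polynomial.

Two elements of a division algebra are conjugate iff they have the same trace and norm
(`IsDivision.isInnerConj_iff`), that is, the same quadratic polynomial. By alternativity, `r` is a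
root of `f` iff `x - r` is a right factor of `f` (`eval_eq_zero_iff`). The central step is
`exists_eval_eq_zero_of_quadratic_dvd`: if `q_z` divides `N(f)`, then `f` has a root conjugate to
`z`. Indeed `f = q_z g + (u x + v)`, and `q_z` divides `N(u x + v)`, which has degree at most two,
so that `N(u x + v) = Norm(u) q_z`; if `u ≠ 0`, this says that the root `-u⁻¹ v` of `u x + v` has
the trace and norm of `z`, and `f` vanishes at it; if `u = 0`, then `v = 0`. Splitting off linear
factors one at a time gives a factorization from a decomposition, with the prescribed conjugacy
classes (`exists_eq_linearProd`).

The decomposition is unique because `q_y` and `q_z` are equal as soon as they have an irreducible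
factor in common (`quadratic_eq_of_dvd`): a polynomial `q_z` with a root `t` in `F` is `(x - t) ^
2`, as `Norm(z - t) = 0` forces `z = t`. Unique factorization in `F[x]` then identifies the
multisets of quadratic factors, and identifies the classes of roots `r`, for which `q_r` divides
`N(f)`.
-/

noncomputable section

namespace OctonionAlgebra

/-! ### Octonion algebras over a commutative ring -/

section Ring
variable {R : Type*} [CommRing R] {a b c d : R}

theorem norm_mul (x y : OctonionAlgebra R a b c d) : norm (x * y) = norm x * norm y := by
  simp [norm, conj]
  ring

theorem conj_mul_mul_self (x y : OctonionAlgebra R a b c d) :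
    conj x * (x * y) = norm x • y := by
  ext <;> simp [norm, conj] <;> ring

theorem mul_mul_conj_self (x y : OctonionAlgebra R a b c d) :
    (y * x) * conj x = norm x • y := by
  ext <;> simp [norm, conj] <;> ring

theorem trace_mul_comm (x y : OctonionAlgebra R a b c d) : trace (x * y) = trace (y * x) := by
  simp [trace, conj]; ring

@[simp] theorem conj_conj (x : OctonionAlgebra R a b c d) : conj (conj x) = x := by
  ext <;> simp [conj]

@[simp] theorem norm_conj (x : OctonionAlgebra R a b c d) : norm (conj x) = norm x := by
  simp [norm, conj]; ring

theorem conj_eq (x : OctonionAlgebra R a b c d) : conj x = trace x • 1 - x := by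
  rw [trace_smul_one]; abel

@[simp] theorem norm_one : norm (1 : OctonionAlgebra R a b c d) = 1 := by
  simp [norm, conj]

theorem norm_smul (r : R) (x : OctonionAlgebra R a b c d) : norm (r • x) = r ^ 2 * norm x := by
  simp [norm, conj]; ring

theorem trace_smul (r : R) (x : OctonionAlgebra R a b c d) : trace (r • x) = r * trace x := by
  simp [trace, conj]; ring

/-- The norm is a quadratic form, with polar form `Tr(x̄ y)`. -/
theorem norm_add (x y : OctonionAlgebra R a b c d) :
    norm (x + y) = norm x + norm y + trace (conj x * y) := by
  simp [norm, trace, conj]; ring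

theorem norm_sub_smul_one (x : OctonionAlgebra R a b c d) (r : R) :
    norm (x - r • 1) = r ^ 2 - trace x * r + norm x := by
  simp [norm, trace, conj]; ring

/-- Every element is a root of its quadratic polynomial. -/
theorem mul_self_eq (x : OctonionAlgebra R a b c d) : x * x = trace x • x - norm x • 1 := by
  rw [norm_smul_one, conj_eq, sub_mul, smul_mul_assoc, one_mul]; abel

/-- Right alternativity. -/
theorem mul_mul_self (x y : OctonionAlgebra R a b c d) : (y * x) * x = y * (x * x) := by
  have h := mul_mul_conj_self x y
  rw [conj_eq, mul_sub, mul_smul_comm, mul_one, sub_eq_iff_eq_add'] at h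
  rw [mul_self_eq, mul_sub, mul_smul_comm, mul_smul_comm, mul_one, h]
  abel

theorem smul_one_mul (r : R) (x : OctonionAlgebra R a b c d) : (r • 1) * x = r • x := by
  rw [smul_mul_assoc, one_mul]

theorem IsInnerConj.trace_eq {x y : OctonionAlgebra R a b c d} (h : IsInnerConj x y) :
    trace y = trace x := by
  obtain ⟨u, v, huv, hvu, rfl⟩ := h
  have hn : norm u * norm v = 1 := by rw [← norm_mul, huv, norm_one]
  have hv : v = norm v • conj u := by
    have h := conj_mul_mul_self u v
    rw [huv, mul_one] at h
    rw [h, smul_smul, mul_comm, hn, one_smul]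
  rw [trace_mul_comm, hv, smul_mul_assoc, conj_mul_mul_self, smul_smul, mul_comm, hn, one_smul]

theorem IsInnerConj.norm_eq {x y : OctonionAlgebra R a b c d} (h : IsInnerConj x y) :
    norm y = norm x := by
  obtain ⟨u, v, huv, hvu, rfl⟩ := h
  have hn : norm u * norm v = 1 := by rw [← norm_mul, huv, norm_one]
  rw [norm_mul, norm_mul, mul_right_comm, hn, one_mul]

end Ring

/-! ### Conjugacy in octonion division algebras -/

section Field
variable {F : Type*} [Field F] {a b c d : F}

theorem conj_eq_zero {x : OctonionAlgebra F a b c d} : conj x = 0 ↔ x = 0 := by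
  constructor
  · intro h; rw [← conj_conj x, h, map_zero]
  · rintro rfl; exact map_zero _

theorem IsDivision.norm_ne_zero (hdiv : IsDivision F a b c d) {x : OctonionAlgebra F a b c d}
    (hx : x ≠ 0) : norm x ≠ 0 := by
  intro h
  have h0 : conj x * x = conj x * 0 := by rw [← norm_smul_one, h, zero_smul, mul_zero]
  exact hx ((hdiv _ (conj_eq_zero.not.mpr hx)).1.1 h0)

theorem IsDivision.isInnerConj_of_mul_eq (hdiv : IsDivision F a b c d)
    {x y u : OctonionAlgebra F a b c d} (hu : u ≠ 0) (h : y * u = u * x) : IsInnerConj x y := by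
  have hn := hdiv.norm_ne_zero hu
  refine ⟨u, (norm u)⁻¹ • conj u, ?_, ?_, ?_⟩
  · have := norm_smul_one (conj u)
    rw [conj_conj, norm_conj] at this
    rw [mul_smul_comm, ← this, smul_smul, inv_mul_cancel₀ hn, one_smul]
  · rw [smul_mul_assoc, ← norm_smul_one, smul_smul, inv_mul_cancel₀ hn, one_smul]
  · rw [← h, mul_smul_comm, mul_mul_conj_self, smul_smul, inv_mul_cancel₀ hn, one_smul]

/-- A nonzero `u` orthogonal to `1` and `x` for the polar form of the norm: `ℓ` and
`i ℓ` are orthogonal to `1`, and some nonzero combination of them is orthogonal to `x`. -/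
theorem exists_orthogonal (x : OctonionAlgebra F a b c d) :
    ∃ u : OctonionAlgebra F a b c d, u ≠ 0 ∧ trace u = 0 ∧ trace (conj u * x) = 0 := by
  let e₁ : OctonionAlgebra F a b c d := ⟨0, 1⟩
  let e₂ : OctonionAlgebra F a b c d := ⟨0, ⟨0, 1, 0, 0⟩⟩
  by_cases h : trace (conj e₁ * x) = 0
  · refine ⟨e₁, fun h0 => ?_, ?_, h⟩
    · simpa [e₁] using congrArg (fun z => z.snd.re) h0
    · simp [e₁, trace, conj]
  · refine ⟨trace (conj e₁ * x) • e₂ - trace (conj e₂ * x) • e₁, fun h0 => h ?_, ?_, ?_⟩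
    · simpa [e₁, e₂] using congrArg (fun z => z.snd.imI) h0
    · simp [e₁, e₂, trace, conj]
    · have hsub : ∀ y z : OctonionAlgebra F a b c d, trace (y - z) = trace y - trace z := by
        intro y z; simp [trace]; ring
      rw [map_sub, map_smul, map_smul, sub_mul, smul_mul_assoc, smul_mul_assoc, hsub, trace_smul,
        trace_smul]
      ring

/-- Conjugacy is decided by trace and norm. The element `u = y - x̄` satisfies `y u = u x`; if it
vanishes, any `u` orthogonal to `1` and `x` does. -/
theorem IsDivision.isInnerConj_iff (hdiv : IsDivision F a b c d)
    {x y : OctonionAlgebra F a b c d} :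
    IsInnerConj x y ↔ trace y = trace x ∧ norm y = norm x := by
  refine ⟨fun h => ⟨h.trace_eq, h.norm_eq⟩, fun ⟨ht, hn⟩ => ?_⟩
  by_cases h : y - conj x = 0
  · obtain ⟨u, hu, hu₁, hux⟩ := exists_orthogonal x
    refine hdiv.isInnerConj_of_mul_eq hu ?_
    rw [sub_eq_zero.mp h]
    -- Polarizing, `0 = Tr(ū x) = ū x + x̄ u`, and `ū = -u`.
    have hcu : conj u = -u := by rw [conj_eq, hu₁, zero_smul, zero_sub]
    have hrev : conj (conj u * x) = conj x * u := by
      ext <;> simp [conj]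
    have := trace_smul_one (conj u * x)
    rw [hux, zero_smul, hrev, hcu, neg_mul] at this
    rw [eq_comm, neg_add_eq_zero] at this
    exact this.symm
  · refine hdiv.isInnerConj_of_mul_eq h ?_
    have hx : conj x * x = norm x • 1 := (norm_smul_one x).symm
    have hyx : y * conj x = trace x • y - y * x := by
      rw [conj_eq, mul_sub, mul_smul_comm, mul_one]
    rw [mul_sub, sub_mul, mul_self_eq, hx, hyx, ht, hn]
    abel

end Field
end OctonionAlgebra

namespace OctonionPoly
open Polynomial
variable {F : Type*} [Field F] {a b c d : F}

/-! ### `A[x]` inside the octonion algebra over `F[x]` -/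

/-- The octonion algebra over `F[x]` with the same parameters as `A`. -/
abbrev Extended (F : Type*) [Field F] (a b c d : F) : Type _ :=
  OctonionAlgebra F[X] (C a) (C b) (C c) (C d)

/-- The inclusion of `A` in its extension of scalars to `F[x]`. -/
def mapC : OctonionAlgebra F a b c d →+ Extended F a b c d where
  toFun z := ⟨⟨C z.fst.re, C z.fst.imI, C z.fst.imJ, C z.fst.imK⟩,
    ⟨C z.snd.re, C z.snd.imI, C z.snd.imJ, C z.snd.imK⟩⟩
  map_zero' := by ext1 <;> ext1 <;> simp
  map_add' x y := by ext1 <;> ext1 <;> simp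

theorem mapC_one : mapC (1 : OctonionAlgebra F a b c d) = 1 := by
  ext1 <;> ext1 <;> simp [mapC]

theorem mapC_smul (r : F) (z : OctonionAlgebra F a b c d) : mapC (r • z) = C r • mapC z := by
  ext1 <;> ext1 <;> simp [mapC]

theorem mapC_mul (x y : OctonionAlgebra F a b c d) : mapC (x * y) = mapC x * mapC y := by
  ext1 <;> ext1 <;>
    simp only [mapC, AddMonoidHom.coe_mk, ZeroHom.coe_mk, OctonionAlgebra.fst_mul,
      OctonionAlgebra.snd_mul, QuaternionAlgebra.re_add, QuaternionAlgebra.imI_add,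
      QuaternionAlgebra.imJ_add, QuaternionAlgebra.imK_add, QuaternionAlgebra.re_smul,
      QuaternionAlgebra.imI_smul, QuaternionAlgebra.imJ_smul, QuaternionAlgebra.imK_smul,
      QuaternionAlgebra.re_mul, QuaternionAlgebra.imI_mul, QuaternionAlgebra.imJ_mul,
      QuaternionAlgebra.imK_mul, QuaternionAlgebra.re_star, QuaternionAlgebra.imI_star,
      QuaternionAlgebra.imJ_star, QuaternionAlgebra.imK_star, smul_eq_mul, C_add, C_sub, C_mul,
      C_neg]

theorem mapC_conj (x : OctonionAlgebra F a b c d) :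
    mapC (OctonionAlgebra.conj x) = OctonionAlgebra.conj (mapC x) := by
  ext1 <;> ext1 <;> simp [mapC, OctonionAlgebra.conj]

theorem norm_mapC (x : OctonionAlgebra F a b c d) : (mapC x).norm = C x.norm := by
  simp [mapC, OctonionAlgebra.norm, OctonionAlgebra.conj]
  ring

theorem trace_mapC (x : OctonionAlgebra F a b c d) : (mapC x).trace = C x.trace := by
  simp [mapC, OctonionAlgebra.trace, OctonionAlgebra.conj]

/-- The comparison `A[x] → Extended F a b c d`, `z ⊗ p ↦ p z`. It lets identities in `A[x]` be
deduced from those in octonion algebras over commutative rings. -/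
def toExtended : OctonionPoly F a b c d →+ Extended F a b c d :=
  TensorProduct.liftAddHom
    (AddMonoidHom.mk' (fun z => AddMonoidHom.mk' (fun p => p • mapC z) fun p q => add_smul p q _)
      fun y z => AddMonoidHom.ext fun p => by simp)
    fun r z p => by simp [mapC_smul, smul_smul, smul_eq_C_mul, mul_comm]

@[simp] theorem toExtended_tmul (z : OctonionAlgebra F a b c d) (p : F[X]) :
    toExtended (z ⊗ₜ[F] p) = p • mapC z := rfl

/-- The inverse of `toExtended`, on the coordinates with respect to the standard basis of `A`. -/
def ofExtended : Extended F a b c d →+ OctonionPoly F a b c d :=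
  AddMonoidHom.mk' (fun y =>
    (⟨⟨1, 0, 0, 0⟩, 0⟩ : OctonionAlgebra F a b c d) ⊗ₜ y.fst.re +
    (⟨⟨0, 1, 0, 0⟩, 0⟩ : OctonionAlgebra F a b c d) ⊗ₜ y.fst.imI +
    (⟨⟨0, 0, 1, 0⟩, 0⟩ : OctonionAlgebra F a b c d) ⊗ₜ y.fst.imJ +
    (⟨⟨0, 0, 0, 1⟩, 0⟩ : OctonionAlgebra F a b c d) ⊗ₜ y.fst.imK +
    (⟨0, ⟨1, 0, 0, 0⟩⟩ : OctonionAlgebra F a b c d) ⊗ₜ y.snd.re +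
    (⟨0, ⟨0, 1, 0, 0⟩⟩ : OctonionAlgebra F a b c d) ⊗ₜ y.snd.imI +
    (⟨0, ⟨0, 0, 1, 0⟩⟩ : OctonionAlgebra F a b c d) ⊗ₜ y.snd.imJ +
    (⟨0, ⟨0, 0, 0, 1⟩⟩ : OctonionAlgebra F a b c d) ⊗ₜ y.snd.imK)
    fun x y => by simp [TensorProduct.tmul_add]; abel

theorem ofExtended_toExtended (f : OctonionPoly F a b c d) : ofExtended (toExtended f) = f := by
  induction f using TensorProduct.induction_on with
  | zero => simp
  | add f g hf hg => rw [map_add, map_add, hf, hg]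
  | tmul z p =>
    have h : ∀ (e : OctonionAlgebra F a b c d) (r : F), e ⊗ₜ[F] (p * C r) = (r • e) ⊗ₜ[F] p := by
      intro e r
      rw [mul_comm, ← smul_eq_C_mul, TensorProduct.smul_tmul]
    simp only [ofExtended, AddMonoidHom.mk'_apply, toExtended_tmul, OctonionAlgebra.fst_smul,
      OctonionAlgebra.snd_smul, mapC, AddMonoidHom.coe_mk, ZeroHom.coe_mk,
      QuaternionAlgebra.re_smul, QuaternionAlgebra.imI_smul, QuaternionAlgebra.imJ_smul,
      QuaternionAlgebra.imK_smul, smul_eq_mul, h, ← TensorProduct.add_tmul]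
    congr 1
    ext1 <;> ext1 <;> simp

theorem toExtended_injective :
    Function.Injective (toExtended : OctonionPoly F a b c d →+ Extended F a b c d) :=
  Function.LeftInverse.injective ofExtended_toExtended

theorem toExtended_mul (f g : OctonionPoly F a b c d) :
    toExtended (f * g) = toExtended f * toExtended g := by
  induction f using TensorProduct.induction_on with
  | zero => simp
  | add f f' hf hf' => rw [add_mul, map_add, map_add, add_mul, hf, hf']
  | tmul z p =>
    induction g using TensorProduct.induction_on with
    | zero => simp
    | add f f' hf hf' => rw [mul_add, map_add, map_add, mul_add, hf, hf']
    | tmul w q =>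
      simp [mapC_mul, mul_smul_comm, smul_mul_assoc, smul_smul, mul_comm]

theorem toExtended_conj (f : OctonionPoly F a b c d) :
    toExtended (conj f) = OctonionAlgebra.conj (toExtended f) := by
  induction f using TensorProduct.induction_on with
  | zero => simp
  | add f f' hf hf' => rw [map_add, map_add, map_add, map_add, hf, hf']
  | tmul z p => simp [conj, mapC_conj]

theorem toExtended_ofCentral (p : F[X]) :
    toExtended (ofCentral p : OctonionPoly F a b c d) = p • 1 := by
  simp [ofCentral, mapC_one]

theorem toExtended_const (z : OctonionAlgebra F a b c d) : toExtended (const z) = mapC z := by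
  simp [const]

theorem ofCentral_injective :
    Function.Injective (ofCentral : F[X] → OctonionPoly F a b c d) := by
  intro p q h
  have := congrArg (fun f => (toExtended f).fst.re) h
  simpa [toExtended_ofCentral] using this

/-- The companion polynomial as an element of `F[x]`; see `companion_eq`. -/
def normPoly (f : OctonionPoly F a b c d) : F[X] := (toExtended f).norm

theorem companion_eq (f : OctonionPoly F a b c d) : companion f = ofCentral (normPoly f) := by
  apply toExtended_injective
  rw [companion, toExtended_mul, toExtended_conj, ← OctonionAlgebra.norm_smul_one,
    toExtended_ofCentral, normPoly]

theorem companion_eq_ofCentral {f : OctonionPoly F a b c d} {p : F[X]} :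
    companion f = ofCentral p ↔ normPoly f = p := by
  rw [companion_eq, ofCentral_injective.eq_iff]

theorem normPoly_mul (f g : OctonionPoly F a b c d) :
    normPoly (f * g) = normPoly f * normPoly g := by
  rw [normPoly, toExtended_mul, OctonionAlgebra.norm_mul]; rfl

theorem normPoly_const (z : OctonionAlgebra F a b c d) : normPoly (const z) = C z.norm := by
  rw [normPoly, toExtended_const, norm_mapC]

/-! ### Norms of affine polynomials and of products of linear factors -/

/-- The polynomial `u x + v`. -/
def affine (u v : OctonionAlgebra F a b c d) : OctonionPoly F a b c d := u ⊗ₜ X + const v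

theorem normPoly_affine (u v : OctonionAlgebra F a b c d) :
    normPoly (affine u v) = C u.norm * X ^ 2 + C (OctonionAlgebra.conj u * v).trace * X +
      C v.norm := by
  rw [normPoly, affine, map_add, toExtended_tmul, toExtended_const, OctonionAlgebra.norm_add,
    OctonionAlgebra.norm_smul, map_smul, smul_mul_assoc, OctonionAlgebra.trace_smul, norm_mapC,
    norm_mapC, ← mapC_conj, ← mapC_mul, trace_mapC]
  ring

theorem linear_eq_affine (z : OctonionAlgebra F a b c d) : linear z = affine 1 (-z) := by
  rw [linear, affine, ofCentral, const, const, TensorProduct.neg_tmul, sub_eq_add_neg]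

theorem normPoly_linear (z : OctonionAlgebra F a b c d) : normPoly (linear z) = quadratic z := by
  have h₁ : OctonionAlgebra.conj (1 : OctonionAlgebra F a b c d) = 1 := by
    ext <;> simp [OctonionAlgebra.conj]
  rw [linear_eq_affine, normPoly_affine, h₁, one_mul, ← neg_one_smul F z,
    OctonionAlgebra.norm_smul, OctonionAlgebra.trace_smul, OctonionAlgebra.norm_one, quadratic]
  simp
  ring

theorem normPoly_linearProd (e : OctonionAlgebra F a b c d) :
    ∀ {n : ℕ} (l : Fin n → OctonionAlgebra F a b c d),
      normPoly (linearProd e l) = C e.norm * ∏ k, quadratic (l k)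
  | 0, l => by simp [linearProd, normPoly_const]
  | n + 1, l => by
    rw [linearProd, normPoly_mul, normPoly_linearProd, normPoly_linear, Fin.prod_univ_succ]
    simp only [Fin.tail]
    ring

/-! ### Coefficients, substitution and division -/

@[simp] theorem coeff_tmul (k : ℕ) (z : OctonionAlgebra F a b c d) (p : F[X]) :
    coeff k (z ⊗ₜ[F] p) = p.coeff k • z := by
  simp [coeff]

theorem coeff_eq_coeff_toExtended (f : OctonionPoly F a b c d) (k : ℕ) :
    coeff k f = ⟨⟨(toExtended f).fst.re.coeff k, (toExtended f).fst.imI.coeff k,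
      (toExtended f).fst.imJ.coeff k, (toExtended f).fst.imK.coeff k⟩,
      ⟨(toExtended f).snd.re.coeff k, (toExtended f).snd.imI.coeff k,
      (toExtended f).snd.imJ.coeff k, (toExtended f).snd.imK.coeff k⟩⟩ := by
  induction f using TensorProduct.induction_on with
  | zero => simp; rfl
  | add f f' hf hf' =>
    rw [map_add, map_add, hf, hf']
    ext1 <;> ext1 <;> simp
  | tmul z p =>
    rw [coeff_tmul]
    ext1 <;> ext1 <;> simp [mapC]

theorem ext_coeff {f g : OctonionPoly F a b c d} (h : ∀ k, coeff k f = coeff k g) : f = g := by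
  apply toExtended_injective
  simp only [coeff_eq_coeff_toExtended, OctonionAlgebra.mk.injEq, QuaternionAlgebra.mk.injEq] at h
  ext k <;> simp [h k]

theorem exists_coeff_eq_zero (f : OctonionPoly F a b c d) : ∃ m, ∀ k, m ≤ k → coeff k f = 0 := by
  induction f using TensorProduct.induction_on with
  | zero => exact ⟨0, fun k _ => map_zero _⟩
  | add f f' hf hf' =>
    obtain ⟨m, hm⟩ := hf
    obtain ⟨m', hm'⟩ := hf'
    refine ⟨max m m', fun k hk => ?_⟩
    rw [map_add, hm k (le_of_max_le_left hk), hm' k (le_of_max_le_right hk), add_zero]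
  | tmul z p =>
    refine ⟨p.natDegree + 1, fun k hk => ?_⟩
    rw [coeff_tmul, p.coeff_eq_zero_of_natDegree_lt hk, zero_smul]

theorem coeff_mul_linear_succ (f : OctonionPoly F a b c d) (z : OctonionAlgebra F a b c d)
    (k : ℕ) : coeff (k + 1) (f * linear z) = coeff k f - coeff (k + 1) f * z := by
  induction f using TensorProduct.induction_on with
  | zero => simp
  | add f f' hf hf' => rw [add_mul, map_add, map_add, map_add, hf, hf', add_mul]; abel
  | tmul w p => simp [linear, mul_sub, ofCentral, const, smul_mul_assoc]

/-- A right factor `x - z` lowers the degree by one and does not change the leading coefficient. -/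
theorem HasLeadingTerm.of_mul_linear {f g : OctonionPoly F a b c d}
    {z e : OctonionAlgebra F a b c d} {n : ℕ} (hf : HasLeadingTerm f (n + 1) e)
    (h : f = g * linear z) : HasLeadingTerm g n e := by
  obtain ⟨h₁, h₂, h₃⟩ := hf
  subst h
  obtain ⟨m, hm⟩ := exists_coeff_eq_zero g
  -- Comparing coefficients downwards from `m` shows that those of `g` above `x ^ n` vanish.
  have key : ∀ j k, m ≤ k + j → n < k → coeff k g = 0 := by
    intro j
    induction j with
    | zero => exact fun k hk _ => hm k hk
    | succ j ih =>
      intro k hk hn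
      have := h₃ (k + 1) (by omega)
      rwa [coeff_mul_linear_succ, ih (k + 1) (by omega) (by omega), zero_mul, sub_zero] at this
  refine ⟨?_, h₂, fun k hk => key m k (by omega) hk⟩
  rwa [coeff_mul_linear_succ, key m (n + 1) (by omega) (by omega), zero_mul, sub_zero] at h₁

theorem HasLeadingTerm.eq_const {f : OctonionPoly F a b c d} {e : OctonionAlgebra F a b c d}
    (hf : HasLeadingTerm f 0 e) : f = const e := by
  refine ext_coeff fun k => ?_
  rcases k with _ | k
  · simp [hf.1, const]
  · simp [hf.2.2 (k + 1) (by omega), const, coeff_one]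

@[simp] theorem eval_tmul_monomial (r z : OctonionAlgebra F a b c d) (k : ℕ) (s : F) :
    eval r (z ⊗ₜ[F] monomial k s) = s • (z * r.pow k) := by
  simp [eval, lsum_apply]

theorem pow_add_two (r : OctonionAlgebra F a b c d) (k : ℕ) :
    r.pow (k + 2) = r.trace • r.pow (k + 1) - r.norm • r.pow k := by
  change (r.pow k * r) * r = r.trace • (r.pow k * r) - r.norm • r.pow k
  rw [OctonionAlgebra.mul_mul_self, OctonionAlgebra.mul_self_eq, mul_sub, mul_smul_comm,
    mul_smul_comm, mul_one]

/-- The case of Artin's theorem that makes substitution of `r` compatible with right multiplication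
by `x - r`; both sides satisfy the recurrence `pow_add_two`. -/
theorem mul_mul_pow (r z : OctonionAlgebra F a b c d) :
    ∀ k, (z * r) * r.pow k = z * r.pow (k + 1)
  | 0 => by simp [OctonionAlgebra.pow]
  | 1 => by
    simp only [OctonionAlgebra.pow, one_mul]
    exact OctonionAlgebra.mul_mul_self r z
  | k + 2 => by
    rw [pow_add_two, mul_sub, mul_smul_comm, mul_smul_comm, mul_mul_pow r z (k + 1),
      mul_mul_pow r z k, ← mul_smul_comm, ← mul_smul_comm, ← mul_sub, ← pow_add_two]

/-- Every polynomial is a sum of monomials. -/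
theorem induction_on_monomial {P : OctonionPoly F a b c d → Prop} (f : OctonionPoly F a b c d)
    (add : ∀ f g, P f → P g → P (f + g)) (mon : ∀ z k s, P (z ⊗ₜ[F] monomial k s)) : P f := by
  induction f using TensorProduct.induction_on with
  | zero => simpa using mon 0 0 0
  | add f g hf hg => exact add f g hf hg
  | tmul z p =>
    induction p using Polynomial.induction_on' with
    | add p q hp hq => rw [TensorProduct.tmul_add]; exact add _ _ hp hq
    | monomial k s => exact mon z k s

/-- Right division by `x - r`, with the value at `r` as the remainder. -/
theorem exists_eq_mul_linear_add (r : OctonionAlgebra F a b c d) (f : OctonionPoly F a b c d) :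
    ∃ g, f = g * linear r + const (eval r f) := by
  induction f using induction_on_monomial with
  | add f f' hf hf' =>
    obtain ⟨g, hg⟩ := hf
    obtain ⟨g', hg'⟩ := hf'
    refine ⟨g + g', ?_⟩
    nth_rewrite 1 [hg, hg']
    rw [map_add, add_mul, const, const, const, TensorProduct.add_tmul]
    abel
  | mon z k s =>
    induction k generalizing z with
    | zero =>
      refine ⟨0, ?_⟩
      rw [eval_tmul_monomial, zero_mul, zero_add, const, TensorProduct.smul_tmul]
      simp [OctonionAlgebra.pow, smul_eq_C_mul]
    | succ k ih =>
      obtain ⟨g, hg⟩ := ih (z * r)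
      refine ⟨z ⊗ₜ monomial k s + g, ?_⟩
      rw [eval_tmul_monomial, mul_mul_pow, ← eval_tmul_monomial] at hg
      rw [add_mul, add_assoc, ← hg]
      simp [linear, mul_sub, ofCentral, const, monomial_mul_X]

theorem eval_mul_linear (r : OctonionAlgebra F a b c d) (f : OctonionPoly F a b c d) :
    eval r (f * linear r) = 0 := by
  induction f using induction_on_monomial with
  | add f f' hf hf' => rw [add_mul, map_add, hf, hf', add_zero]
  | mon z k s => simp [linear, mul_sub, ofCentral, const, monomial_mul_X, mul_mul_pow]

/-- An element is a root precisely when `x - r` is a right factor. -/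
theorem eval_eq_zero_iff {r : OctonionAlgebra F a b c d} {f : OctonionPoly F a b c d} :
    eval r f = 0 ↔ ∃ g, f = g * linear r := by
  constructor
  · intro h
    obtain ⟨g, hg⟩ := exists_eq_mul_linear_add r f
    exact ⟨g, by simpa [h, const] using hg⟩
  · rintro ⟨g, rfl⟩
    exact eval_mul_linear r g

/-- Multiples of the quadratic polynomial of `z` vanish at every element with the same quadratic
polynomial. -/
theorem eval_ofCentral_quadratic_mul {r z : OctonionAlgebra F a b c d}
    (h : quadratic r = quadratic z) (f : OctonionPoly F a b c d) :
    eval r (ofCentral (quadratic z) * f) = 0 := by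
  rw [← h]
  induction f using induction_on_monomial with
  | add f f' hf hf' => rw [mul_add, map_add, hf, hf', add_zero]
  | mon w k s =>
    have : quadratic r * monomial k s =
        monomial (k + 2) s - monomial (k + 1) (r.trace * s) + monomial k (r.norm * s) := by
      simp only [quadratic, ← C_mul_X_pow_eq_monomial, C_mul]
      ring
    rw [ofCentral, Algebra.TensorProduct.tmul_mul_tmul, one_mul, this, TensorProduct.tmul_add,
      TensorProduct.tmul_sub, map_add, map_sub, eval_tmul_monomial, eval_tmul_monomial,
      eval_tmul_monomial, pow_add_two, mul_sub, mul_smul_comm, mul_smul_comm, smul_sub, smul_smul,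
      smul_smul, mul_comm s, mul_comm s]
    abel

theorem eval_affine (r u v : OctonionAlgebra F a b c d) : eval r (affine u v) = u * r + v := by
  have h₁ : eval r (const v) = v := by
    have := eval_tmul_monomial r v 0 1
    simpa [OctonionAlgebra.pow, const] using this
  have h₂ : eval r (u ⊗ₜ[F] X) = u * r := by
    rw [← monomial_one_one_eq_X, eval_tmul_monomial]
    simp [OctonionAlgebra.pow]
  rw [affine, map_add, h₁, h₂]

/-! ### Quadratic polynomials and conjugacy -/

theorem quadratic_monic (z : OctonionAlgebra F a b c d) : (quadratic z).Monic := by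
  unfold quadratic; monicity!

theorem natDegree_quadratic (z : OctonionAlgebra F a b c d) : (quadratic z).natDegree = 2 := by
  unfold quadratic; compute_degree!

theorem quadratic_eq_iff {y z : OctonionAlgebra F a b c d} :
    quadratic y = quadratic z ↔ y.trace = z.trace ∧ y.norm = z.norm := by
  constructor
  · intro h
    have h₀ := congrArg (Polynomial.coeff · 0) h
    have h₁ := congrArg (Polynomial.coeff · 1) h
    simp [quadratic, coeff_X, coeff_X_pow] at h₀ h₁
    exact ⟨h₁, h₀⟩
  · rintro ⟨h₁, h₂⟩
    rw [quadratic, quadratic, h₁, h₂]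

theorem isInnerConj_iff_quadratic_eq (hdiv : OctonionAlgebra.IsDivision F a b c d)
    {y z : OctonionAlgebra F a b c d} :
    OctonionAlgebra.IsInnerConj y z ↔ quadratic y = quadratic z := by
  rw [hdiv.isInnerConj_iff, quadratic_eq_iff]
  exact ⟨fun h => ⟨h.1.symm, h.2.symm⟩, fun h => ⟨h.1.symm, h.2.symm⟩⟩

/-! ### Roots from quadratic divisors of the companion polynomial -/

/-- Division with remainder by a quadratic polynomial, which is central and monic. -/
theorem exists_eq_quadratic_mul_add_affine (z : OctonionAlgebra F a b c d)
    (f : OctonionPoly F a b c d) :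
    ∃ g u v, f = ofCentral (quadratic z) * g + affine u v := by
  induction f using TensorProduct.induction_on with
  | zero => exact ⟨0, 0, 0, by simp [affine, const]⟩
  | add f f' hf hf' =>
    obtain ⟨g, u, v, h⟩ := hf
    obtain ⟨g', u', v', h'⟩ := hf'
    refine ⟨g + g', u + u', v + v', ?_⟩
    rw [h, h', mul_add, affine, affine, affine, const, const, const, TensorProduct.add_tmul,
      TensorProduct.add_tmul]
    abel
  | tmul w p =>
    have hdeg : (p %ₘ quadratic z).natDegree ≤ 1 := by
      have := natDegree_modByMonic_lt p (quadratic_monic z)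
        (fun h => by simpa [h] using natDegree_quadratic z)
      rw [natDegree_quadratic] at this
      omega
    obtain ⟨s, t, hst⟩ := exists_eq_X_add_C_of_natDegree_le_one hdeg
    refine ⟨w ⊗ₜ (p /ₘ quadratic z), s • w, t • w, ?_⟩
    nth_rewrite 1 [← modByMonic_add_div p (quadratic z), hst]
    rw [ofCentral, Algebra.TensorProduct.tmul_mul_tmul, one_mul, affine, const,
      TensorProduct.smul_tmul, TensorProduct.smul_tmul, smul_eq_C_mul, smul_eq_C_mul, mul_one,
      TensorProduct.tmul_add, TensorProduct.tmul_add]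
    abel

/-- If the quadratic polynomial of `z` divides the companion polynomial of `f`, then some conjugate
of `z` is a root of `f`. With `f = q g + (u x + v)` and `q` the quadratic polynomial, degree reasons
force the companion polynomial of `u x + v` to be `Norm(u) q`, so that `- u⁻¹ v` has the trace and
norm of `z` if `u ≠ 0`, whereas `u x + v = 0` if `u = 0`. -/
theorem exists_eval_eq_zero_of_quadratic_dvd (hdiv : OctonionAlgebra.IsDivision F a b c d)
    {z : OctonionAlgebra F a b c d} {f : OctonionPoly F a b c d}
    (h : quadratic z ∣ normPoly f) : ∃ r, quadratic r = quadratic z ∧ eval r f = 0 := by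
  obtain ⟨g, u, v, rfl⟩ := exists_eq_quadratic_mul_add_affine z f
  suffices H : ∃ r, quadratic r = quadratic z ∧ u * r + v = 0 by
    obtain ⟨r, hr, huv⟩ := H
    exact ⟨r, hr, by rw [map_add, eval_ofCentral_quadratic_mul hr, eval_affine, huv, add_zero]⟩
  have hdvd : quadratic z ∣ normPoly (affine u v) := by
    rw [normPoly, map_add, OctonionAlgebra.norm_add, toExtended_mul, toExtended_ofCentral,
      OctonionAlgebra.smul_one_mul, OctonionAlgebra.norm_smul, map_smul, smul_mul_assoc,
      OctonionAlgebra.trace_smul, add_right_comm] at h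
    refine (dvd_add_right ?_).mp h
    exact dvd_add (dvd_mul_of_dvd_left (dvd_pow_self _ two_ne_zero) _) (dvd_mul_right _ _)
  have heq : normPoly (affine u v) = C u.norm * quadratic z := by
    rw [← sub_eq_zero]
    refine eq_zero_of_dvd_of_natDegree_lt (dvd_sub hdvd (dvd_mul_left _ _)) ?_
    rw [natDegree_quadratic, normPoly_affine]
    have : C u.norm * X ^ 2 + C (OctonionAlgebra.conj u * v).trace * X + C v.norm -
        C u.norm * quadratic z = C ((OctonionAlgebra.conj u * v).trace + u.norm * z.trace) * X +
        C (v.norm - u.norm * z.norm) := by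
      simp only [quadratic, C_add, C_sub, C_mul]
      ring
    rw [this]
    exact natDegree_linear_le.trans_lt one_lt_two
  rw [normPoly_affine] at heq
  have h₀ := congrArg (Polynomial.coeff · 0) heq
  have h₁ := congrArg (Polynomial.coeff · 1) heq
  simp [quadratic, coeff_X, coeff_X_pow] at h₀ h₁
  by_cases hu : u = 0
  · refine ⟨z, rfl, ?_⟩
    by_contra hv
    rw [hu, zero_mul, zero_add] at hv
    refine hdiv.norm_ne_zero hv ?_
    rw [h₀, hu]
    simp [OctonionAlgebra.norm]
  · have hn := hdiv.norm_ne_zero hu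
    refine ⟨-(u.norm)⁻¹ • (OctonionAlgebra.conj u * v), quadratic_eq_iff.mpr ⟨?_, ?_⟩, ?_⟩
    · rw [OctonionAlgebra.trace_smul, h₁]
      field_simp
    · rw [OctonionAlgebra.norm_smul, OctonionAlgebra.norm_mul, OctonionAlgebra.norm_conj, h₀]
      field_simp
    · have := OctonionAlgebra.conj_mul_mul_self (OctonionAlgebra.conj u) v
      rw [OctonionAlgebra.conj_conj, OctonionAlgebra.norm_conj] at this
      rw [mul_smul_comm, this, smul_smul, neg_mul, inv_mul_cancel₀ hn, neg_one_smul,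
        neg_add_cancel]

/-! ### Uniqueness of quadratic decompositions -/

theorem eq_smul_one_of_isRoot_quadratic (hdiv : OctonionAlgebra.IsDivision F a b c d)
    {z : OctonionAlgebra F a b c d} {t : F} (h : (quadratic z).IsRoot t) : z = t • 1 := by
  by_contra hz
  refine hdiv.norm_ne_zero (sub_ne_zero.mpr hz) ?_
  rw [OctonionAlgebra.norm_sub_smul_one]
  simpa [quadratic, IsRoot.def] using h

/-- Over a division algebra, quadratic polynomials with a common factor are equal: their difference
has degree at most one, hence is zero or has a root `t` that is common to both, and then both
elements are `t`. -/
theorem quadratic_eq_of_dvd (hdiv : OctonionAlgebra.IsDivision F a b c d)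
    {y z : OctonionAlgebra F a b c d} {p : F[X]} (hp : Irreducible p) (hy : p ∣ quadratic y)
    (hz : p ∣ quadratic z) : quadratic y = quadratic z := by
  by_contra hne
  have hsub : quadratic y - quadratic z = C (z.trace - y.trace) * X + C (y.norm - z.norm) := by
    simp only [quadratic, C_sub]
    ring
  have hdeg : p.natDegree ≤ 1 :=
    (natDegree_le_of_dvd (dvd_sub hy hz) (sub_ne_zero.mpr hne)).trans
      (hsub ▸ natDegree_linear_le)
  have hdeg : p.degree = 1 := by
    rw [degree_eq_natDegree hp.ne_zero, le_antisymm hdeg hp.natDegree_pos, Nat.cast_one]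
  obtain ⟨t, ht⟩ := exists_root_of_degree_eq_one hdeg
  exact hne (by rw [eq_smul_one_of_isRoot_quadratic hdiv (ht.dvd hy),
    eq_smul_one_of_isRoot_quadratic hdiv (ht.dvd hz)])

/-- A quadratic polynomial dividing a product of such is one of the factors. -/
theorem exists_quadratic_eq_of_dvd_prod (hdiv : OctonionAlgebra.IsDivision F a b c d)
    {z : OctonionAlgebra F a b c d} {s : Multiset (OctonionAlgebra F a b c d)}
    (h : quadratic z ∣ (s.map quadratic).prod) : ∃ y ∈ s, quadratic z = quadratic y := by
  obtain ⟨p, hp, hpz⟩ := exists_irreducible_of_natDegree_pos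
    (natDegree_quadratic z ▸ two_pos : 0 < (quadratic z).natDegree)
  obtain ⟨y, hy, hpy⟩ := hp.prime.exists_mem_multiset_map_dvd (hpz.trans h)
  exact ⟨y, hy, quadratic_eq_of_dvd hdiv hp hpz hpy⟩

theorem map_quadratic_eq_of_prod_eq (hdiv : OctonionAlgebra.IsDivision F a b c d)
    (s t : Multiset (OctonionAlgebra F a b c d))
    (h : (s.map quadratic).prod = (t.map quadratic).prod) :
    s.map quadratic = t.map quadratic := by
  induction s using Multiset.induction_on generalizing t with
  | empty =>
    have ht : t = 0 := by
      rw [Multiset.eq_zero_iff_forall_notMem]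
      intro y hy
      have hdvd := Multiset.dvd_prod (Multiset.mem_map_of_mem quadratic hy)
      rw [← h, Multiset.map_zero, Multiset.prod_zero] at hdvd
      have := natDegree_eq_zero_of_isUnit (isUnit_of_dvd_one hdvd)
      rw [natDegree_quadratic] at this
      omega
    rw [ht]
  | cons z s ih =>
    rw [Multiset.map_cons, Multiset.prod_cons] at h
    obtain ⟨y, hy, hzy⟩ := exists_quadratic_eq_of_dvd_prod hdiv (Dvd.intro _ h)
    obtain ⟨t, rfl⟩ := Multiset.exists_cons_of_mem hy
    rw [Multiset.map_cons, Multiset.prod_cons, hzy] at h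
    rw [Multiset.map_cons, Multiset.map_cons, hzy,
      ih t (mul_left_cancel₀ (quadratic_monic y).ne_zero h)]

/-- Families with the same multiset of values differ by a permutation of the index type, glued from
bijections between the fibres. -/
theorem exists_perm_of_map_univ_eq {ι α : Type*} [Fintype ι] {f g : ι → α}
    (h : Finset.univ.val.map f = Finset.univ.val.map g) :
    ∃ σ : Equiv.Perm ι, ∀ i, g (σ i) = f i := by
  classical
  have hcard : ∀ x, Nonempty ({i // f i = x} ≃ {i // g i = x}) := by
    intro x
    rw [← Fintype.card_eq, Fintype.card_subtype, Fintype.card_subtype]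
    have := congrArg (Multiset.count x) h
    rw [Multiset.count_map, Multiset.count_map] at this
    simpa only [Finset.card_def, Finset.filter_val, eq_comm] using this
  let E := ((Equiv.sigmaFiberEquiv f).symm.trans
    (Equiv.sigmaCongrRight fun x => (hcard x).some)).trans (Equiv.sigmaFiberEquiv g)
  exact ⟨E, fun i => ((hcard (f i)).some ⟨i, rfl⟩).2⟩

/-! ### Factorization -/

/-- A polynomial with decomposed companion polynomial is a product of linear factors: a root
conjugate to the first of the given elements splits off a factor on the right, and the companion
polynomial of the cofactor loses the corresponding factor. -/
theorem exists_eq_linearProd (hdiv : OctonionAlgebra.IsDivision F a b c d)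
    {e : OctonionAlgebra F a b c d} {n : ℕ} {f : OctonionPoly F a b c d}
    (hf : HasLeadingTerm f n e) (g : Fin n → OctonionAlgebra F a b c d)
    (hg : normPoly f = C e.norm * ∏ k, quadratic (g k)) :
    ∃ l : Fin n → OctonionAlgebra F a b c d,
      f = linearProd e l ∧ ∀ k, quadratic (l k) = quadratic (g k) := by
  induction n generalizing f with
  | zero => exact ⟨g, hf.eq_const, fun _ => rfl⟩
  | succ n ih =>
    rw [Fin.prod_univ_succ, mul_left_comm] at hg
    obtain ⟨r, hr, hrf⟩ := exists_eval_eq_zero_of_quadratic_dvd hdiv (Dvd.intro _ hg.symm)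
    obtain ⟨f', rfl⟩ := eval_eq_zero_iff.mp hrf
    rw [normPoly_mul, normPoly_linear, hr, mul_comm] at hg
    obtain ⟨l, hl, hlg⟩ := ih (hf.of_mul_linear rfl) (fun k => g k.succ)
      (mul_left_cancel₀ (quadratic_monic _).ne_zero hg)
    refine ⟨Fin.cons r l, ?_, Fin.cases ?_ ?_⟩
    · rw [linearProd, Fin.tail_cons, Fin.cons_zero, hl]
    · simpa using hr
    · simpa using hlg

end OctonionPoly

end

/-- `A = OctonionAlgebra F a b c d` is an octonion division algebra over `F`, and `f` is a polynomial
of degree `n` over `A` with leading coefficient `e`. -/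
theorem mainTheorem1 {F : Type*} [Field F] (a b c d : F)
    (hab : b ^ 2 + 4 * a ≠ 0) (hc : c ≠ 0) (hd : d ≠ 0)
    (hdiv : OctonionAlgebra.IsDivision F a b c d)
    (n : ℕ) (f : OctonionPoly F a b c d) (e : OctonionAlgebra F a b c d)
    (hf : f.HasLeadingTerm n e) :
    -- `f` factors into linear factors iff its companion polynomial decomposes
    ((∃ l : Fin n → OctonionAlgebra F a b c d, f = OctonionPoly.linearProd e l) ↔
      ∃ g : Fin n → OctonionAlgebra F a b c d,
        f.companion = OctonionPoly.ofCentral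
          (Polynomial.C e.norm * ∏ k, OctonionPoly.quadratic (g k))) ∧
    -- for a given decomposition, `l k` can be taken to be a conjugate of `g k`
    (∀ g : Fin n → OctonionAlgebra F a b c d,
      f.companion = OctonionPoly.ofCentral
          (Polynomial.C e.norm * ∏ k, OctonionPoly.quadratic (g k)) →
      ∃ l : Fin n → OctonionAlgebra F a b c d,
        f = OctonionPoly.linearProd e l ∧ ∀ k, OctonionAlgebra.IsInnerConj (g k) (l k)) ∧
    -- for any factorization and any decomposition, the `l k` are conjugates of the `g k`, up to
    -- the order
    (∀ l g : Fin n → OctonionAlgebra F a b c d,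
      f = OctonionPoly.linearProd e l →
      f.companion = OctonionPoly.ofCentral
          (Polynomial.C e.norm * ∏ k, OctonionPoly.quadratic (g k)) →
      ∃ σ : Equiv.Perm (Fin n), ∀ k, OctonionAlgebra.IsInnerConj (g (σ k)) (l k)) ∧
    -- for any factorization, the conjugacy classes of the `l k` are those of the roots of `f`
    (∀ l : Fin n → OctonionAlgebra F a b c d, f = OctonionPoly.linearProd e l →
      ∀ z : OctonionAlgebra F a b c d,
        (∃ k, OctonionAlgebra.IsInnerConj (l k) z) ↔
          ∃ r : OctonionAlgebra F a b c d,
            OctonionPoly.eval r f = 0 ∧ OctonionAlgebra.IsInnerConj r z) := by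
  have hne : Polynomial.C e.norm ≠ 0 := Polynomial.C_ne_zero.mpr (hdiv.norm_ne_zero hf.2.1)
  simp only [OctonionPoly.companion_eq_ofCentral, OctonionPoly.isInnerConj_iff_quadratic_eq hdiv]
  refine ⟨⟨?_, ?_⟩, ?_, ?_, ?_⟩
  · rintro ⟨l, rfl⟩
    exact ⟨l, OctonionPoly.normPoly_linearProd e l⟩
  · rintro ⟨g, hg⟩
    obtain ⟨l, hl, -⟩ := OctonionPoly.exists_eq_linearProd hdiv hf g hg
    exact ⟨l, hl⟩
  · intro g hg
    obtain ⟨l, hl, hlg⟩ := OctonionPoly.exists_eq_linearProd hdiv hf g hg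
    exact ⟨l, hl, fun k => (hlg k).symm⟩
  · rintro l g rfl hg
    rw [OctonionPoly.normPoly_linearProd] at hg
    have h := OctonionPoly.map_quadratic_eq_of_prod_eq hdiv (Finset.univ.val.map l)
      (Finset.univ.val.map g) (by
        rw [Multiset.map_map, Multiset.map_map]
        exact mul_left_cancel₀ hne hg)
    rw [Multiset.map_map, Multiset.map_map] at h
    exact OctonionPoly.exists_perm_of_map_univ_eq h
  · rintro l rfl z
    have hN := OctonionPoly.normPoly_linearProd e l
    constructor
    · rintro ⟨k, hk⟩
      obtain ⟨r, hr, h0⟩ := OctonionPoly.exists_eval_eq_zero_of_quadratic_dvd hdiv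
        (hN ▸ (Finset.dvd_prod_of_mem _ (Finset.mem_univ k)).mul_left _)
      exact ⟨r, h0, hr.trans hk⟩
    · rintro ⟨r, h0, hr⟩
      obtain ⟨g, hg⟩ := OctonionPoly.eval_eq_zero_iff.mp h0
      rw [hg, OctonionPoly.normPoly_mul, OctonionPoly.normPoly_linear] at hN
      have hdvd := Dvd.intro_left _ hN
      rw [(Polynomial.isUnit_C.mpr (hdiv.norm_ne_zero hf.2.1).isUnit).dvd_mul_left] at hdvd
      obtain ⟨y, hy, hry⟩ := OctonionPoly.exists_quadratic_eq_of_dvd_prod hdiv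
        (s := Finset.univ.val.map l) (by rw [Multiset.map_map]; exact hdvd)
      obtain ⟨k, -, rfl⟩ := Multiset.mem_map.mp hy
      exact ⟨k, hry.symm.trans hr⟩
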